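/- For integers $a,b$ let $E_{(a,b)}$ denote the short Weierstrass equation $Y^2=X^3+aX+b$, with naive height $H(E_{(a,b)})=\max\{4|a|^3,27b^2\}$. The density of a set $A\subseteq\mathbb{Z}^2$ is $$\mathfrak d(A)=\lim_{x\to\infty}\frac{\#\{(a,b)\in A : H(E_{(a,b)})\le x\}}{\#\{(a,b)\in\mathbb{Z}^2 : H(E_{(a,b)})\le x\}}$$ when this limit exists. For a prime $\ell$ let $v_\ell$ be the normalized $\ell$-adic valuation, with $v_\ell(0)=\infty$. The equation $E_{(a,b)}$ is called minimal if for every prime $\ell$ (including $2$ and $3$) $v_\ell(a)<4$ or $v_\ell(b)<6$. For $n\ge 1$, $E_{(a,b)}$ has Kodaira type $\mathrm I_n$ at $\ell$, as determined by Tate's algorithm, if over $\mathbb{Q}_\ell$ it is isomorphic, by an admissible change of variables, to a Weierstrass equation $y^2+a_1xy+a_3y=x^3+a_2x^2+a_4x+a_6$ with coefficients in $\mathbb{Z}_\ell$ such that $\ell\mid a_3,a_4,a_6$, $\ell\nmid b_2=a_1^2+4a_2$, and whose discriminant has valuation exactly $n$. (1) The set of minimal equations $E_{(a,b)}$, $(a,b)\in\mathbb{Z}^2$,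 has a density, and it equals $$\prod_{\ell}\left(1-\ell^{-10}\right)=\frac1{\zeta(10)},$$ where $\ell$ runs over all prime numbers and the product converges. (2) Let $\Sigma$ be a finite set of primes $\ge 5$ and let $n\ge 1$ be an integer. Let $\mathcal W_{\Sigma,n}$ be the set of minimal equations $E_{(a,b)}$ that have Kodaira type $\mathrm I_n$ at every $\ell\in\Sigma$. Then $\mathcal W_{\Sigma,n}$ has a density, and $$\mathfrak d(\mathcal W_{\Sigma,n})=\prod_{\ell\in\Sigma}\frac{(\ell-1)^2}{\ell^{n+2}}\cdot\prod_{\ell\notin\Sigma}\left(1-\ell^{-10}\right),$$ where the second product runs over all primes not in $\Sigma$ and converges. -/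

import Mathlib

open Filter Topology

namespace ShortWeierstrass

/-- The short Weierstrass equation `Y² = X³ + aX + b` over a commutative ring. -/
def curve {R : Type*} [CommRing R] (a b : R) : WeierstrassCurve R :=
  ⟨0, 0, 0, a, b⟩

/-- `HasKodairaTypeI R W n`: the Weierstrass curve `W` over the fraction field `K` of the discrete
valuation ring `R` (with maximal ideal `𝔪`, perfect residue field) has Kodaira type `I_n`, as
determined by Tate's algorithm. The algorithm may be started from any Weierstrass equation `V` with
coefficients in `R` of the given curve, i.e. obtained from `W` by an admissible change of
variables over `K`. It returns

* `I_0` (good reduction) when the discriminant of `V` is a unit;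
* otherwise, once the singular point of the reduction of `V` has been moved to the origin, that is
  `a₃, a₄, a₆ ∈ 𝔪`, it returns `I_n` with `n = v(Δ)` when `b₂ = a₁² + 4 a₂` is a unit (the singular
  point is a node). When `b₂ ∈ 𝔪` (a cusp), it goes on to the additive types or to an equation
  with smaller discriminant. -/
def HasKodairaTypeI (R : Type*) [CommRing R] [IsDomain R] [IsDiscreteValuationRing R]
    {K : Type*} [Field K] [Algebra R K] [IsFractionRing R K]
    (W : WeierstrassCurve K) (n : ℕ) : Prop :=
  ∃ (C : WeierstrassCurve.VariableChange K) (V : WeierstrassCurve R),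
    C • W = V.map (algebraMap R K) ∧
    ((n = 0 ∧ IsUnit V.Δ) ∨
      (1 ≤ n ∧
        V.a₃ ∈ IsLocalRing.maximalIdeal R ∧
        V.a₄ ∈ IsLocalRing.maximalIdeal R ∧
        V.a₆ ∈ IsLocalRing.maximalIdeal R ∧
        IsUnit V.b₂ ∧
        V.Δ ∈ IsLocalRing.maximalIdeal R ^ n ∧
        V.Δ ∉ IsLocalRing.maximalIdeal R ^ (n + 1)))

/-- The pairs `(a, b)` over `ℤ_ℓ` with `v(a) < 4` or `v(b) < 6` (where `v(0) = ∞`). -/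
def localMinimal (ℓ : ℕ) [Fact ℓ.Prime] : Set (ℤ_[ℓ] × ℤ_[ℓ]) :=
  {p | ¬ (ℓ : ℤ_[ℓ]) ^ 4 ∣ p.1 ∨ ¬ (ℓ : ℤ_[ℓ]) ^ 6 ∣ p.2}

/-- The pairs `(a, b)` over `ℤ_ℓ` such that `Y² = X³ + aX + b` has Kodaira type `I_n` at `ℓ`. -/
def localTypeI (ℓ : ℕ) [Fact ℓ.Prime] (n : ℕ) : Set (ℤ_[ℓ] × ℤ_[ℓ]) :=
  {p | HasKodairaTypeI ℤ_[ℓ] ((curve p.1 p.2).map (algebraMap ℤ_[ℓ] ℚ_[ℓ])) n}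

/-- The natural map from pairs of integers to pairs of `ℓ`-adic integers. -/
noncomputable def toLocal (ℓ : ℕ) [Fact ℓ.Prime] (p : ℤ × ℤ) : ℤ_[ℓ] × ℤ_[ℓ] :=
  ((p.1 : ℤ_[ℓ]), (p.2 : ℤ_[ℓ]))

/-- The set of minimal short Weierstrass equations over `ℤ`: minimal at every prime. -/
def minimalModels : Set (ℤ × ℤ) :=
  {p | ∀ ℓ : Nat.Primes, haveI : Fact (ℓ : ℕ).Prime := ⟨ℓ.2⟩
    toLocal (ℓ : ℕ) p ∈ localMinimal (ℓ : ℕ)}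

/-- The set of minimal short Weierstrass equations over `ℤ` which have Kodaira type `I_n` at every
prime of `S`. -/
def minimalModelsOfType (S : Finset Nat.Primes) (n : ℕ) : Set (ℤ × ℤ) :=
  {p | p ∈ minimalModels ∧ ∀ ℓ ∈ S, haveI : Fact (ℓ : ℕ).Prime := ⟨ℓ.2⟩
    toLocal (ℓ : ℕ) p ∈ localTypeI (ℓ : ℕ) n}

/-- The naïve height `max (4 |a|³) (27 b²)`. -/
def height (p : ℤ × ℤ) : ℤ :=
  max (4 * |p.1| ^ 3) (27 * p.2 ^ 2)

/-- The elements of `A` of naïve height at most `x`. -/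
def upTo (A : Set (ℤ × ℤ)) (x : ℝ) : Set (ℤ × ℤ) :=
  {p | p ∈ A ∧ (height p : ℝ) ≤ x}

/-- There are finitely many pairs of bounded height, so the cardinalities below are the true
ones. -/
theorem finite_upTo (A : Set (ℤ × ℤ)) (x : ℝ) : (upTo A x).Finite := by
  refine ((Set.finite_Icc (-⌈x⌉) ⌈x⌉).prod (Set.finite_Icc (-⌈x⌉) ⌈x⌉)).subset ?_
  rintro ⟨a, b⟩ ⟨-, h⟩
  have h' : height (a, b) ≤ ⌈x⌉ := by exact_mod_cast h.trans (Int.le_ceil x)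
  obtain ⟨h1, h2⟩ := max_le_iff.1 h'
  have ha : |a| ≤ ⌈x⌉ := by
    rcases (abs_nonneg a).eq_or_lt with h0 | h0
    · rw [← h0] at h1 ⊢; simpa using h1
    · have : (1 : ℤ) ≤ |a| := h0
      have h3 : |a| ≤ |a| ^ 3 := le_self_pow₀ this (by norm_num)
      simp only at h1
      linarith
  have hb : |b| ≤ ⌈x⌉ := by
    have h3 : |b| ≤ b ^ 2 := by
      rcases abs_cases b with ⟨h, -⟩ | ⟨h, -⟩ <;> rw [h] <;> nlinarith [Int.le_self_sq b, Int.le_self_sq (-b)]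
    simp only at h2
    nlinarith [sq_nonneg b]
  exact ⟨abs_le.1 ha, abs_le.1 hb⟩

/-- `A` has density `d` with respect to the naïve height among all pairs of integers. -/
def HasDensity (A : Set (ℤ × ℤ)) (d : ℝ) : Prop :=
  Tendsto (fun x : ℝ => ((upTo A x).ncard : ℝ) / ((upTo Set.univ x).ncard : ℝ)) atTop (𝓝 d)

end ShortWeierstrass

/-!
Minimality at `ℓ` says that `ℓ ^ 4 ∣ a` and `ℓ ^ 6 ∣ b` do not both hold, a congruence condition
modulo `ℓ ^ 6` of density `1 - ℓ ^ (-10)`. For `ℓ ≥ 5`, a minimal equation has type `I_n`, `n ≥ 1`,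
if and only if `ℓ ∤ a` and `4 a³ + 27 b²` has valuation exactly `n` (`minimal_and_typeI_iff`):
since `c₄` of a nodal equation is a unit, minimality forces the change of variables to have unit
scaling factor; conversely the node can be moved to the origin explicitly. Modulo `ℓ ^ k` the
solutions of `4 a³ + 27 b² = 0` with `a` a unit are parametrized by units via
`t ↦ (-3 t², 2 t³)`, so they have density `(ℓ - 1) / ℓ ^ (k + 1)`, and subtracting the values for
`k = n` and `k = n + 1` gives `(ℓ - 1)² / ℓ ^ (n + 2)` (`hasBoxDensity_typeI`).

The pairs of height at most `x` form a box `[-A, A] × [-B, B]` with `A` and `B` tending to infinity,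
so it suffices to compute densities along boxes. Conditions modulo coprime integers are independent
there (`HasBoxDensity.inter`), which handles finitely many primes. To pass to all primes,
the pairs that are nonminimal at some prime outside a finite set `F` have upper density at most
`∑ ℓ ^ (-10)` over `ℓ ∉ F` (`boxRatio_nonminimalOutside_le`), which tends to zero as `F` grows. The
sieve `hasBoxDensity_iInter` combines the two.
-/

namespace ShortWeierstrass

/-! ### Densities along boxes -/

/-- The integer points of the box `[-A, A] × [-B, B]`, where `q = (A, B)`. -/
noncomputable def box (q : ℕ × ℕ) : Finset (ℤ × ℤ) :=
  Finset.Icc (-(q.1 : ℤ)) q.1 ×ˢ Finset.Icc (-(q.2 : ℤ)) q.2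

/-- The proportion of points of `box q` that lie in `S`, written as a sum of indicators so that it
is additive in `S`. -/
noncomputable def boxRatio (S : Set (ℤ × ℤ)) (q : ℕ × ℕ) : ℝ :=
  (∑ p ∈ box q, S.indicator 1 p) / (box q).card

/-- `S` has density `d` along boxes whose two sides tend to infinity independently. This is
stronger than density with respect to the height, whose boxes form a one-parameter family. -/
def HasBoxDensity (S : Set (ℤ × ℤ)) (d : ℝ) : Prop :=
  Tendsto (boxRatio S) atTop (𝓝 d)

theorem card_box (q : ℕ × ℕ) : ((box q).card : ℝ) = (2 * q.1 + 1) * (2 * q.2 + 1) := by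
  have h (n : ℕ) : ((n : ℤ) + 1 - -(n : ℤ)).toNat = 2 * n + 1 := by omega
  rw [box, Finset.card_product, Int.card_Icc, Int.card_Icc, h, h]
  push_cast
  ring

theorem card_box_pos (q : ℕ × ℕ) : (0 : ℝ) < (box q).card := by
  rw [card_box]
  positivity

theorem boxRatio_mono {S T : Set (ℤ × ℤ)} (h : S ⊆ T) (q : ℕ × ℕ) :
    boxRatio S q ≤ boxRatio T q := by
  unfold boxRatio
  gcongr with p _
  exact zero_le_one

theorem boxRatio_le_add {S T U : Set (ℤ × ℤ)} (h : S ⊆ T ∪ U) (q : ℕ × ℕ) :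
    boxRatio S q ≤ boxRatio T q + boxRatio U q := by
  classical
  unfold boxRatio
  rw [← add_div, ← Finset.sum_add_distrib]
  gcongr with p _
  by_cases hS : p ∈ S
  · rcases h hS with h | h
    · simp only [Set.indicator_of_mem hS, Set.indicator_of_mem h, Pi.one_apply,
        le_add_iff_nonneg_right]
      exact Set.indicator_nonneg (fun _ _ => zero_le_one) p
    · simp only [Set.indicator_of_mem hS, Set.indicator_of_mem h, Pi.one_apply,
        le_add_iff_nonneg_left]
      exact Set.indicator_nonneg (fun _ _ => zero_le_one) p
  · rw [Set.indicator_of_notMem hS]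
    exact add_nonneg (Set.indicator_nonneg (fun _ _ => zero_le_one) p)
      (Set.indicator_nonneg (fun _ _ => zero_le_one) p)

theorem HasBoxDensity.diff {S T : Set (ℤ × ℤ)} {d e : ℝ} (hS : HasBoxDensity S d)
    (hT : HasBoxDensity T e) (h : T ⊆ S) : HasBoxDensity (S \ T) (d - e) := by
  refine (Tendsto.sub hS hT).congr fun q => ?_
  rw [boxRatio, boxRatio, boxRatio, ← sub_div, ← Finset.sum_sub_distrib]
  congr 1
  refine Finset.sum_congr rfl fun p _ => ?_
  by_cases hpT : p ∈ T
  · simp [hpT, h hpT]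
  · by_cases hpS : p ∈ S <;> simp [hpS, hpT]

theorem hasBoxDensity_univ : HasBoxDensity Set.univ 1 := by
  refine tendsto_const_nhds.congr fun q => ?_
  have := card_box_pos q
  simp only [boxRatio, Set.indicator_univ, Pi.one_apply, Finset.sum_const, nsmul_eq_mul, mul_one]
  rw [div_self this.ne']

theorem tendsto_inv_two_mul_add_one :
    Tendsto (fun n : ℕ => ((2 * n + 1 : ℝ))⁻¹) atTop (𝓝 0) := by
  refine tendsto_inv_atTop_zero.comp (tendsto_atTop_add_const_right _ _ ?_)
  exact tendsto_natCast_atTop_atTop.const_mul_atTop two_pos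

/-- A residue class modulo `m` has `(2 A + 1) / m + O(1)` elements in `[-A, A]`. -/
theorem abs_residue_count_sub_le {m : ℕ} (hm : 0 < m) (r : ℤ) (A : ℕ) :
    |(∑ a ∈ Finset.Icc (-(A : ℤ)) A, ({a : ℤ | a ≡ r [ZMOD m]}.indicator 1 a : ℝ)) -
      (2 * A + 1) / m| ≤ 1 := by
  classical
  have hsum : (∑ a ∈ Finset.Icc (-(A : ℤ)) A, ({a : ℤ | a ≡ r [ZMOD m]}.indicator 1 a : ℝ)) =
      (((Finset.Ioc (-(A : ℤ) - 1) A).filter fun a => a ≡ r [ZMOD m]).card : ℝ) := by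
    have : Finset.Icc (-(A : ℤ)) A = Finset.Ioc (-(A : ℤ) - 1) A := by
      ext a
      simp only [Finset.mem_Icc, Finset.mem_Ioc]
      omega
    rw [this, Finset.card_filter]
    push_cast
    refine Finset.sum_congr rfl fun a _ => ?_
    simp [Set.indicator_apply]
  have hcard := Int.Ioc_filter_modEq_card (-(A : ℤ) - 1) A (Int.natCast_pos.2 hm) r
  have hm' : (0 : ℚ) < m := by exact_mod_cast hm
  have key : |((((Finset.Ioc (-(A : ℤ) - 1) A).filter fun a => a ≡ r [ZMOD m]).card : ℤ) : ℚ) -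
      (2 * A + 1) / m| ≤ 1 := by
    rw [hcard]
    set x : ℚ := ((A : ℤ) - r : ℚ) / ((m : ℤ) : ℚ)
    set y : ℚ := (((-(A : ℤ) - 1 : ℤ) : ℚ) - r) / ((m : ℤ) : ℚ)
    have hxy : x - y = (2 * A + 1) / m := by
      simp only [x, y]
      push_cast
      field_simp
      ring
    have hle : y ≤ x := by
      have : 0 ≤ x - y := by rw [hxy]; positivity
      linarith
    rw [max_eq_left (sub_nonneg.2 (Int.floor_le_floor hle)), ← hxy, abs_le]
    push_cast
    constructor <;> linarith [Int.floor_le x, Int.floor_le y, Int.lt_floor_add_one x,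
      Int.lt_floor_add_one y]
  have key' := (Rat.cast_le (K := ℝ)).2 key
  push_cast at key'
  rwa [hsum]

theorem tendsto_residue_ratio {m : ℕ} (hm : 0 < m) (r : ℤ) :
    Tendsto (fun A : ℕ => (∑ a ∈ Finset.Icc (-(A : ℤ)) A,
      ({a : ℤ | a ≡ r [ZMOD m]}.indicator 1 a : ℝ)) / (2 * A + 1)) atTop (𝓝 (1 / m)) := by
  rw [← tendsto_sub_nhds_zero_iff]
  refine squeeze_zero_norm (fun A => ?_) tendsto_inv_two_mul_add_one
  have key := abs_residue_count_sub_le hm r A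
  set N := ∑ a ∈ Finset.Icc (-(A : ℤ)) A, ({a : ℤ | a ≡ r [ZMOD m]}.indicator 1 a : ℝ)
  have hA : (0 : ℝ) < 2 * A + 1 := by positivity
  have hm' : (m : ℝ) ≠ 0 := by exact_mod_cast hm.ne'
  have : N / (2 * A + 1) - 1 / m = (N - (2 * A + 1) / m) / (2 * A + 1) := by field_simp
  rw [Real.norm_eq_abs, this, abs_div, abs_of_pos hA, ← one_div]
  gcongr

theorem sum_box_indicator_prod (s t : Set ℤ) (q : ℕ × ℕ) :
    (∑ p ∈ box q, (s ×ˢ t).indicator 1 p : ℝ) =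
      (∑ a ∈ Finset.Icc (-(q.1 : ℤ)) q.1, s.indicator 1 a) *
        ∑ b ∈ Finset.Icc (-(q.2 : ℤ)) q.2, t.indicator 1 b := by
  rw [box, Finset.sum_product, Finset.sum_mul_sum]
  refine Finset.sum_congr rfl fun a _ => Finset.sum_congr rfl fun b _ => ?_
  by_cases ha : a ∈ s <;> by_cases hb : b ∈ t <;> simp [ha, hb]

theorem hasBoxDensity_residue {m k : ℕ} (hm : 0 < m) (hk : 0 < k) (r s : ℤ) :
    HasBoxDensity ({a | a ≡ r [ZMOD m]} ×ˢ {b | b ≡ s [ZMOD k]}) (1 / (m * k)) := by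
  have h := ((tendsto_residue_ratio hm r).comp tendsto_fst).mul
    ((tendsto_residue_ratio hk s).comp tendsto_snd)
  rw [prod_atTop_atTop_eq] at h
  rw [HasBoxDensity, ← one_div_mul_one_div]
  refine h.congr fun q => ?_
  rw [boxRatio, card_box, sum_box_indicator_prod, Function.comp_apply, Function.comp_apply,
    div_mul_div_comm]

/-! ### Sets defined by congruences -/

/-- Reduction of a pair of integers modulo `M`. -/
def red (M : ℕ) (p : ℤ × ℤ) : ZMod M × ZMod M := (p.1, p.2)

/-- Membership in `S` depends only on residues modulo `M`. -/
def IsPeriodic (M : ℕ) (S : Set (ℤ × ℤ)) : Prop :=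
  ∃ T : Set (ZMod M × ZMod M), S = red M ⁻¹' T

theorem IsPeriodic.diff {M : ℕ} {S S' : Set (ℤ × ℤ)} (h : IsPeriodic M S)
    (h' : IsPeriodic M S') : IsPeriodic M (S \ S') := by
  obtain ⟨T, rfl⟩ := h
  obtain ⟨T', rfl⟩ := h'
  exact ⟨T \ T', rfl⟩

theorem IsPeriodic.of_dvd {M N : ℕ} (hMN : M ∣ N) {S : Set (ℤ × ℤ)} (h : IsPeriodic M S) :
    IsPeriodic N S := by
  obtain ⟨T, rfl⟩ := h
  refine ⟨Prod.map (ZMod.castHom hMN (ZMod M)) (ZMod.castHom hMN (ZMod M)) ⁻¹' T, ?_⟩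
  ext p
  simp only [Set.mem_preimage, red, Prod.map_apply, map_intCast]

theorem hasBoxDensity_preimage_red (M : ℕ) [NeZero M] (T : Set (ZMod M × ZMod M)) :
    HasBoxDensity (red M ⁻¹' T) (T.ncard / (M : ℝ) ^ 2) := by
  classical
  have hM : 0 < M := Nat.pos_of_neZero M
  have h := tendsto_finsetSum T.toFinset fun t _ =>
    hasBoxDensity_residue hM hM (t.1.val : ℤ) (t.2.val : ℤ)
  have hd : ∑ t ∈ T.toFinset, (1 / ((M : ℝ) * M)) = T.ncard / (M : ℝ) ^ 2 := by
    rw [Finset.sum_const, nsmul_eq_mul, Set.ncard_eq_toFinset_card', sq, mul_one_div]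
  rw [hd] at h
  refine h.congr fun q => ?_
  simp only [boxRatio]
  rw [← Finset.sum_div, Finset.sum_comm]
  congr 1
  refine Finset.sum_congr rfl fun p _ => ?_
  have hmem (t : ZMod M × ZMod M) :
      (p.1 ≡ (t.1.val : ℤ) [ZMOD M] ∧ p.2 ≡ (t.2.val : ℤ) [ZMOD M]) ↔ red M p = t := by
    rw [← ZMod.intCast_eq_intCast_iff, ← ZMod.intCast_eq_intCast_iff, red, Prod.ext_iff]
    simp
  simp only [Set.indicator_apply, Set.mem_prod, Set.mem_ofPred_eq, hmem, Set.mem_preimage,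
    Pi.one_apply, Finset.sum_ite_eq, Set.mem_toFinset]

/-- By the Chinese remainder theorem, congruence conditions to coprime moduli are independent. -/
theorem HasBoxDensity.inter {M N : ℕ} [NeZero M] [NeZero N] (hMN : M.Coprime N)
    {S S' : Set (ℤ × ℤ)} {d d' : ℝ} (hS : IsPeriodic M S) (hS' : IsPeriodic N S')
    (hd : HasBoxDensity S d) (hd' : HasBoxDensity S' d') :
    IsPeriodic (M * N) (S ∩ S') ∧ HasBoxDensity (S ∩ S') (d * d') := by
  obtain ⟨T, rfl⟩ := hS
  obtain ⟨T', rfl⟩ := hS'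
  obtain rfl := tendsto_nhds_unique hd (hasBoxDensity_preimage_red M T)
  obtain rfl := tendsto_nhds_unique hd' (hasBoxDensity_preimage_red N T')
  let c := (ZMod.chineseRemainder hMN).toEquiv
  let e : ZMod (M * N) × ZMod (M * N) ≃ (ZMod M × ZMod M) × (ZMod N × ZMod N) :=
    (c.prodCongr c).trans (Equiv.prodProdProdComm _ _ _ _)
  have he (p : ℤ × ℤ) : e (red (M * N) p) = (red M p, red N p) := by
    have hc (a : ℤ) : c (a : ZMod (M * N)) = ((a : ZMod M), (a : ZMod N)) := by
      change ZMod.chineseRemainder hMN (a : ZMod (M * N)) = _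
      rw [map_intCast]
      rfl
    simp [e, red, hc]
  have hpre : red M ⁻¹' T ∩ red N ⁻¹' T' = red (M * N) ⁻¹' (e ⁻¹' (T ×ˢ T')) := by
    ext p
    simp [he]
  refine ⟨⟨_, hpre⟩, ?_⟩
  have hcard : (e ⁻¹' (T ×ˢ T')).ncard = T.ncard * T'.ncard := by
    rw [Set.ncard_preimage_of_injective_subset_range e.injective (by simp), Set.ncard_prod]
  have h := hasBoxDensity_preimage_red (M * N) (e ⁻¹' (T ×ˢ T'))
  rw [← hpre, hcard] at h
  convert h using 1
  push_cast
  rw [div_mul_div_comm, mul_pow]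

theorem HasBoxDensity.biInter {L : Nat.Primes → Set (ℤ × ℤ)} {d : Nat.Primes → ℝ}
    {e : Nat.Primes → ℕ} (hL : ∀ ℓ : Nat.Primes, IsPeriodic ((ℓ : ℕ) ^ e ℓ) (L ℓ))
    (hd : ∀ ℓ, HasBoxDensity (L ℓ) (d ℓ)) (F : Finset Nat.Primes) :
    IsPeriodic (∏ ℓ ∈ F, (ℓ : ℕ) ^ e ℓ) (⋂ ℓ ∈ F, L ℓ) ∧
      HasBoxDensity (⋂ ℓ ∈ F, L ℓ) (∏ ℓ ∈ F, d ℓ) := by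
  classical
  induction F using Finset.induction_on with
  | empty =>
    simp only [Finset.notMem_empty, Set.iInter_of_empty, Set.iInter_univ, Finset.prod_empty]
    exact ⟨⟨Set.univ, rfl⟩, hasBoxDensity_univ⟩
  | insert ℓ F hℓ ih =>
    have hpos (r : Nat.Primes) : (r : ℕ) ^ e r ≠ 0 := pow_ne_zero _ r.2.ne_zero
    have : NeZero ((ℓ : ℕ) ^ e ℓ) := ⟨hpos ℓ⟩
    have : NeZero (∏ r ∈ F, (r : ℕ) ^ e r) := ⟨Finset.prod_ne_zero_iff.2 fun r _ => hpos r⟩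
    have hcop : ((ℓ : ℕ) ^ e ℓ).Coprime (∏ r ∈ F, (r : ℕ) ^ e r) := by
      refine Nat.Coprime.prod_right fun r hr => Nat.coprime_pow_primes _ _ ℓ.2 r.2 ?_
      intro h
      exact hℓ (Subtype.ext h ▸ hr)
    rw [Finset.set_biInter_insert, Finset.prod_insert hℓ, Finset.prod_insert hℓ]
    exact HasBoxDensity.inter hcop (hL ℓ) ih.1 (hd ℓ) ih.2

/-! ### The tail estimate and the sieve -/

/-- Pairs `(a, b)` with `m ∣ a` and `k ∣ b`, as a product of residue classes. -/
def dvdSet (m k : ℕ) : Set (ℤ × ℤ) := {a | a ≡ 0 [ZMOD m]} ×ˢ {b | b ≡ 0 [ZMOD k]}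

theorem mem_dvdSet {m k : ℕ} {p : ℤ × ℤ} :
    p ∈ dvdSet m k ↔ (m : ℤ) ∣ p.1 ∧ (k : ℤ) ∣ p.2 := by
  simp [dvdSet, Int.modEq_zero_iff_dvd]

/-- Removing the origin cancels the `1` in the product of the two counts. The remaining error,
relative to the size of the box, is summable over `m = ℓ ^ 4`, `k = ℓ ^ 6`. -/
theorem boxRatio_dvdSet_diff_zero_le {m k : ℕ} (hm : 0 < m) (hk : 0 < k) (q : ℕ × ℕ) :
    boxRatio (dvdSet m k \ {0}) q ≤
      ((m : ℝ) * k)⁻¹ + (m : ℝ)⁻¹ * (2 * q.2 + 1 : ℝ)⁻¹ + (k : ℝ)⁻¹ * (2 * q.1 + 1 : ℝ)⁻¹ := by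
  have h0 : (0 : ℤ × ℤ) ∈ box q := by simp [box]
  have h1 : ∑ p ∈ box q, ((dvdSet m k \ {0}).indicator 1 p : ℝ) =
      ∑ p ∈ box q, ((dvdSet m k).indicator 1 p : ℝ) - 1 := by
    classical
    rw [← Finset.add_sum_erase _ _ h0, ← Finset.add_sum_erase (box q) _ h0]
    have : (0 : ℤ × ℤ) ∈ dvdSet m k := by simp [mem_dvdSet]
    simp only [Set.mem_sdiff, Set.mem_singleton_iff, not_true_eq_false, and_false,
      not_false_eq_true, Set.indicator_of_notMem, zero_add, Set.indicator_of_mem this,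
      Pi.one_apply, add_sub_cancel_left]
    refine Finset.sum_congr rfl fun p hp => ?_
    have hp0 := Finset.ne_of_mem_erase hp
    by_cases hpD : p ∈ dvdSet m k <;> simp [hpD, hp0]
  have hx := (abs_le.1 (abs_residue_count_sub_le hm 0 q.1)).2
  have hy := (abs_le.1 (abs_residue_count_sub_le hk 0 q.2)).2
  rw [boxRatio, h1, card_box, dvdSet, sum_box_indicator_prod]
  have hX : 0 ≤ ∑ b ∈ Finset.Icc (-(q.2 : ℤ)) q.2,
      ({b : ℤ | b ≡ 0 [ZMOD k]}.indicator 1 b : ℝ) :=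
    Finset.sum_nonneg fun b _ => Set.indicator_nonneg (fun _ _ => zero_le_one) b
  set X := ∑ a ∈ Finset.Icc (-(q.1 : ℤ)) q.1, ({a : ℤ | a ≡ 0 [ZMOD m]}.indicator 1 a : ℝ)
  set Y := ∑ b ∈ Finset.Icc (-(q.2 : ℤ)) q.2, ({b : ℤ | b ≡ 0 [ZMOD k]}.indicator 1 b : ℝ)
  have hm' : (0 : ℝ) < m := by exact_mod_cast hm
  have hk' : (0 : ℝ) < k := by exact_mod_cast hk
  have hXY : X * Y ≤ ((2 * q.1 + 1) / m + 1) * ((2 * q.2 + 1) / k + 1) := by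
    refine mul_le_mul (by linarith) (by linarith) hX (by positivity)
  calc (X * Y - 1) / ((2 * q.1 + 1) * (2 * q.2 + 1))
      ≤ (((2 * q.1 + 1) / m + 1) * ((2 * q.2 + 1) / k + 1) - 1) /
          ((2 * q.1 + 1) * (2 * q.2 + 1)) := by gcongr
    _ = _ := by
      field_simp
      ring

/-- Pairs that fail to be minimal at some prime outside `F`. -/
def nonminimalOutside (F : Finset Nat.Primes) : Set (ℤ × ℤ) :=
  {p | ∃ ℓ ∉ F, p ∈ dvdSet ((ℓ : ℕ) ^ 4) ((ℓ : ℕ) ^ 6)}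

theorem summable_primes_inv_pow {k : ℕ} (hk : 1 < k) :
    Summable fun ℓ : Nat.Primes => ((ℓ : ℝ) ^ k)⁻¹ :=
  (Real.summable_nat_pow_inv.2 hk).comp_injective Nat.Primes.coe_nat_injective

/-- The upper density of the pairs nonminimal outside `F` is at most `∑ ℓ ^ (-10)` over `ℓ ∉ F`. A
nonzero pair in the box is nonminimal only at primes bounded in terms of the box, so the union over
`ℓ` is a finite one; the origin is counted separately. -/
theorem boxRatio_nonminimalOutside_le (F : Finset Nat.Primes) (q : ℕ × ℕ) :
    boxRatio (nonminimalOutside F) q ≤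
      (∑' ℓ : {ℓ : Nat.Primes // ℓ ∉ F}, (((ℓ : Nat.Primes) : ℝ) ^ 10)⁻¹) +
      (∑' ℓ : Nat.Primes, ((ℓ : ℝ) ^ 4)⁻¹) * (2 * q.2 + 1 : ℝ)⁻¹ +
      ((∑' ℓ : Nat.Primes, ((ℓ : ℝ) ^ 6)⁻¹) + 1) * (2 * q.1 + 1 : ℝ)⁻¹ := by
  classical
  set G : Finset Nat.Primes := ((Finset.range (q.1 + q.2 + 1)).subtype Nat.Prime) \ F
  let D (ℓ : Nat.Primes) : Set (ℤ × ℤ) := dvdSet ((ℓ : ℕ) ^ 4) ((ℓ : ℕ) ^ 6)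
  have hpt : ∀ p ∈ box q, ((nonminimalOutside F).indicator 1 p : ℝ) ≤
      (if p = 0 then 1 else 0) + ∑ ℓ ∈ G, (D ℓ \ {0}).indicator 1 p := by
    intro p hp
    have hnn : 0 ≤ ∑ ℓ ∈ G, ((D ℓ \ {0}).indicator 1 p : ℝ) :=
      Finset.sum_nonneg fun ℓ _ => Set.indicator_nonneg (fun _ _ => zero_le_one) p
    by_cases h0 : p = 0
    · rw [if_pos h0]
      have : ((nonminimalOutside F).indicator 1 p : ℝ) ≤ 1 :=
        Set.indicator_le_self' (fun _ _ => zero_le_one) p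
      linarith
    rw [if_neg h0, zero_add]
    by_cases hpN : p ∈ nonminimalOutside F
    swap
    · rwa [Set.indicator_of_notMem hpN]
    rw [Set.indicator_of_mem hpN]
    obtain ⟨ℓ, hℓF, hℓ⟩ := hpN
    have hbound {a : ℤ} {k N : ℕ} (hk : k ≠ 0) (ha : a ≠ 0) (hd : (((ℓ : ℕ) ^ k : ℕ) : ℤ) ∣ a)
        (h1 : -(N : ℤ) ≤ a) (h2 : a ≤ N) : (ℓ : ℕ) ≤ N := by
      have h3 := Nat.le_of_dvd (Int.natAbs_pos.2 ha) (Int.natCast_dvd.1 hd)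
      have h4 := Nat.le_self_pow hk (ℓ : ℕ)
      omega
    have hmem : ℓ ∈ G := by
      refine Finset.mem_sdiff.2 ⟨Finset.mem_subtype.2 (Finset.mem_range.2 ?_), hℓF⟩
      rw [mem_dvdSet] at hℓ
      simp only [box, Finset.mem_product, Finset.mem_Icc] at hp
      by_cases ha : p.1 = 0
      · have hb : p.2 ≠ 0 := fun hb => h0 (Prod.ext ha hb)
        have := hbound (by norm_num) hb hℓ.2 hp.2.1 hp.2.2
        omega
      · have := hbound (by norm_num) ha hℓ.1 hp.1.1 hp.1.2
        omega
    have hone : ((D ℓ \ {0}).indicator 1 p : ℝ) = 1 := by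
      rw [Set.indicator_of_mem (show p ∈ D ℓ \ {0} from ⟨hℓ, h0⟩), Pi.one_apply]
    rw [Pi.one_apply, ← hone]
    exact Finset.single_le_sum (f := fun ℓ => ((D ℓ \ {0}).indicator 1 p : ℝ))
      (fun ℓ _ => Set.indicator_nonneg (fun _ _ => zero_le_one) p) hmem
  have hcard := card_box_pos q
  have h0 : (0 : ℤ × ℤ) ∈ box q := by simp [box]
  have h1 : boxRatio (nonminimalOutside F) q ≤
      1 / (box q).card + ∑ ℓ ∈ G, boxRatio (D ℓ \ {0}) q := by
    simp only [boxRatio]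
    rw [← Finset.sum_div, ← add_div, Finset.sum_comm]
    gcongr
    refine (Finset.sum_le_sum hpt).trans_eq ?_
    rw [Finset.sum_add_distrib, Finset.sum_ite_eq' (box q) 0, if_pos h0]
  have h2 : ∑ ℓ ∈ G, boxRatio (D ℓ \ {0}) q ≤ ∑ ℓ ∈ G, (((ℓ : ℝ) ^ 10)⁻¹ +
      ((ℓ : ℝ) ^ 4)⁻¹ * (2 * q.2 + 1 : ℝ)⁻¹ + ((ℓ : ℝ) ^ 6)⁻¹ * (2 * q.1 + 1 : ℝ)⁻¹) := by
    refine Finset.sum_le_sum fun ℓ _ => ?_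
    have := boxRatio_dvdSet_diff_zero_le (pow_pos ℓ.2.pos 4) (pow_pos ℓ.2.pos 6) q
    push_cast at this
    rwa [← pow_add] at this
  rw [Finset.sum_add_distrib, Finset.sum_add_distrib, ← Finset.sum_mul, ← Finset.sum_mul] at h2
  have h10 : ∑ ℓ ∈ G, ((ℓ : ℝ) ^ 10)⁻¹ ≤
      ∑' ℓ : {ℓ : Nat.Primes // ℓ ∉ F}, (((ℓ : Nat.Primes) : ℝ) ^ 10)⁻¹ := by
    have hs := (summable_primes_inv_pow (k := 10) (by norm_num)).subtype fun ℓ => ℓ ∉ F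
    have hsub := hs.sum_le_tsum (G.subtype fun ℓ => ℓ ∉ F) fun _ _ => by
      simp only [Function.comp_apply]; positivity
    refine le_of_eq_of_le ?_ hsub
    simp only [Function.comp_apply]
    exact (Finset.sum_subtype_of_mem (p := fun ℓ => ℓ ∉ F)
      (fun ℓ : Nat.Primes => ((ℓ : ℝ) ^ 10)⁻¹) fun ℓ hℓ => (Finset.mem_sdiff.1 hℓ).2).symm
  have h4 := (summable_primes_inv_pow (k := 4) (by norm_num)).sum_le_tsum G
    fun _ _ => by positivity
  have h6 := (summable_primes_inv_pow (k := 6) (by norm_num)).sum_le_tsum G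
    fun _ _ => by positivity
  have hbox : (1 : ℝ) / (box q).card ≤ (2 * q.1 + 1 : ℝ)⁻¹ := by
    rw [card_box, one_div, mul_inv]
    refine mul_le_of_le_one_right (by positivity) (inv_le_one_of_one_le₀ ?_)
    linarith [(Nat.cast_nonneg q.2 : (0 : ℝ) ≤ q.2)]
  have hA : (0 : ℝ) ≤ (2 * q.1 + 1 : ℝ)⁻¹ := by positivity
  have hB : (0 : ℝ) ≤ (2 * q.2 + 1 : ℝ)⁻¹ := by positivity
  have h4' := mul_le_mul_of_nonneg_right h4 hB
  have h6' := mul_le_mul_of_nonneg_right h6 hA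
  linarith

/-- The sieve: local conditions `L ℓ` given by congruences modulo powers of `ℓ` are independent,
also for all primes at once, as long as for all but finitely many `ℓ` they contain all pairs that
are minimal at `ℓ`. -/
theorem hasBoxDensity_iInter {L : Nat.Primes → Set (ℤ × ℤ)} {d : Nat.Primes → ℝ} {D : ℝ}
    {e : Nat.Primes → ℕ} (S : Finset Nat.Primes)
    (hL : ∀ ℓ : Nat.Primes, IsPeriodic ((ℓ : ℕ) ^ e ℓ) (L ℓ))
    (hd : ∀ ℓ, HasBoxDensity (L ℓ) (d ℓ))
    (hmin : ∀ ℓ ∉ S, (dvdSet ((ℓ : ℕ) ^ 4) ((ℓ : ℕ) ^ 6))ᶜ ⊆ L ℓ)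
    (hD : HasProd d D) : HasBoxDensity (⋂ ℓ, L ℓ) D := by
  rw [HasBoxDensity, Metric.tendsto_nhds]
  intro ε hε
  have htail := tendsto_tsum_compl_atTop_zero fun ℓ : Nat.Primes => ((ℓ : ℝ) ^ 10)⁻¹
  have hD' : Tendsto (fun F : Finset Nat.Primes => ∏ ℓ ∈ F, d ℓ) atTop (𝓝 D) := hD
  have hε4 : 0 < ε / 4 := by positivity
  obtain ⟨F, hSF, hF1, hF2⟩ := ((eventually_ge_atTop S).and
    ((Metric.tendsto_nhds.1 hD' _ hε4).and (Metric.tendsto_nhds.1 htail _ hε4))).exists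
  have herr : Tendsto (fun q : ℕ × ℕ =>
      (∑' ℓ : Nat.Primes, ((ℓ : ℝ) ^ 4)⁻¹) * (2 * q.2 + 1 : ℝ)⁻¹ +
      ((∑' ℓ : Nat.Primes, ((ℓ : ℝ) ^ 6)⁻¹) + 1) * (2 * q.1 + 1 : ℝ)⁻¹) atTop (𝓝 0) := by
    have h1 := (tendsto_inv_two_mul_add_one.comp (tendsto_snd (f := (atTop : Filter ℕ)))).const_mul
      (∑' ℓ : Nat.Primes, ((ℓ : ℝ) ^ 4)⁻¹)
    have h2 := (tendsto_inv_two_mul_add_one.comp (tendsto_fst (g := (atTop : Filter ℕ)))).const_mul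
      ((∑' ℓ : Nat.Primes, ((ℓ : ℝ) ^ 6)⁻¹) + 1)
    have h := h1.add h2
    rw [prod_atTop_atTop_eq, mul_zero, mul_zero, add_zero] at h
    exact h
  filter_upwards [Metric.tendsto_nhds.1 (HasBoxDensity.biInter hL hd F).2 _ hε4,
    Metric.tendsto_nhds.1 herr _ hε4] with q hq1 hq2
  have hle : boxRatio (⋂ ℓ, L ℓ) q ≤ boxRatio (⋂ ℓ ∈ F, L ℓ) q :=
    boxRatio_mono (Set.iInter_mono fun ℓ => Set.subset_iInter fun _ => subset_rfl) q
  have hge : boxRatio (⋂ ℓ ∈ F, L ℓ) q ≤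
      boxRatio (⋂ ℓ, L ℓ) q + boxRatio (nonminimalOutside F) q := by
    refine boxRatio_le_add (fun p hp => ?_) q
    by_cases h : p ∈ nonminimalOutside F
    · exact Or.inr h
    refine Or.inl (Set.mem_iInter.2 fun ℓ => ?_)
    by_cases hℓ : ℓ ∈ F
    · exact Set.mem_iInter₂.1 hp ℓ hℓ
    · exact hmin ℓ (fun h' => hℓ (hSF h')) fun h' => h ⟨ℓ, hℓ, h'⟩
  have htl := boxRatio_nonminimalOutside_le F q
  rw [Real.dist_eq] at *
  rw [abs_lt] at *
  constructor <;> linarith [hF1.1, hF1.2, hF2.2, hq1.1, hq1.2, hq2.2]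

/-! ### From boxes to the height -/

theorem upTo_eq_inter_box (S : Set (ℤ × ℤ)) {x : ℝ} (hx : 0 ≤ x) :
    upTo S x = S ∩ box (⌊(x / 4) ^ (3⁻¹ : ℝ)⌋₊, ⌊√(x / 27)⌋₊) := by
  ext ⟨a, b⟩
  have ha : 4 * |(a : ℝ)| ^ 3 ≤ x ↔ |a| ≤ (⌊(x / 4) ^ (3⁻¹ : ℝ)⌋₊ : ℤ) := by
    rw [Int.abs_eq_natAbs, Int.ofNat_le, Nat.le_floor_iff (by positivity), Nat.cast_natAbs,
      Int.cast_abs, Real.le_rpow_inv_iff_of_pos (abs_nonneg _) (by positivity) (by norm_num),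
      le_div_iff₀ (by norm_num), mul_comm]
    norm_cast
  have hb : 27 * (b : ℝ) ^ 2 ≤ x ↔ |b| ≤ (⌊√(x / 27)⌋₊ : ℤ) := by
    rw [Int.abs_eq_natAbs, Int.ofNat_le, Nat.le_floor_iff (by positivity), Nat.cast_natAbs,
      Int.cast_abs, Real.le_sqrt (abs_nonneg _) (by positivity), sq_abs,
      le_div_iff₀ (by norm_num), mul_comm]
  rw [abs_le] at ha hb
  simp only [upTo, height, box, Set.mem_ofPred_eq, Set.mem_inter_iff, Finset.mem_coe,
    Finset.mem_product, Finset.mem_Icc, ← ha, ← hb]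
  push_cast
  rw [max_le_iff]

theorem ncard_inter_box (S : Set (ℤ × ℤ)) (q : ℕ × ℕ) :
    ((S ∩ box q : Set (ℤ × ℤ)).ncard : ℝ) = ∑ p ∈ box q, S.indicator 1 p := by
  classical
  have : (S ∩ box q : Set (ℤ × ℤ)) = ((box q).filter (· ∈ S) : Finset (ℤ × ℤ)) := by
    ext p
    simp [and_comm]
  rw [this, Set.ncard_coe_finset, Finset.card_filter]
  push_cast
  exact Finset.sum_congr rfl fun p _ => by simp [Set.indicator_apply]

theorem HasBoxDensity.hasDensity {S : Set (ℤ × ℤ)} {d : ℝ} (h : HasBoxDensity S d) :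
    HasDensity S d := by
  have hA : Tendsto (fun x : ℝ => ⌊(x / 4) ^ (3⁻¹ : ℝ)⌋₊) atTop atTop :=
    tendsto_nat_floor_atTop.comp ((tendsto_rpow_atTop (by norm_num)).comp
      (tendsto_id.atTop_div_const (by norm_num)))
  have hB : Tendsto (fun x : ℝ => ⌊√(x / 27)⌋₊) atTop atTop :=
    tendsto_nat_floor_atTop.comp (Real.tendsto_sqrt_atTop.comp
      (tendsto_id.atTop_div_const (by norm_num)))
  have hAB := hA.prodMk hB
  rw [prod_atTop_atTop_eq] at hAB
  refine (Tendsto.comp h hAB).congr' ?_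
  filter_upwards [eventually_ge_atTop 0] with x hx
  rw [upTo_eq_inter_box S hx, upTo_eq_inter_box _ hx, ncard_inter_box, Set.univ_inter,
    Set.ncard_coe_finset]
  rfl

/-! ### Kodaira type `I_n` of a minimal short equation -/

section Local

variable {ℓ : ℕ} [Fact ℓ.Prime]

theorem isUnit_six (h5 : 5 ≤ ℓ) : IsUnit (6 : ℤ_[ℓ]) := by
  by_contra h
  rw [PadicInt.not_isUnit_iff] at h
  have h6 : (ℓ : ℤ) ∣ 6 := (PadicInt.norm_int_lt_one_iff_dvd 6).1 (by exact_mod_cast h)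
  have h6' : ℓ ∣ 2 * 3 := by exact_mod_cast h6
  rcases (Fact.out : ℓ.Prime).dvd_mul.1 h6' with h | h
  · have := Nat.le_of_dvd (by norm_num) h
    omega
  · have := Nat.le_of_dvd (by norm_num) h
    omega

theorem isUnit_two_and_three (h5 : 5 ≤ ℓ) : IsUnit (2 : ℤ_[ℓ]) ∧ IsUnit (3 : ℤ_[ℓ]) := by
  have h := isUnit_six h5
  rw [show (6 : ℤ_[ℓ]) = 2 * 3 by norm_num] at h
  exact ⟨isUnit_of_mul_isUnit_left h, isUnit_of_mul_isUnit_right h⟩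

theorem curve_c₄ {R : Type*} [CommRing R] (a b : R) : (curve a b).c₄ = -48 * a := by
  simp only [curve, WeierstrassCurve.c₄, WeierstrassCurve.b₂, WeierstrassCurve.b₄]
  ring

theorem curve_c₆ {R : Type*} [CommRing R] (a b : R) : (curve a b).c₆ = -864 * b := by
  simp only [curve, WeierstrassCurve.c₆, WeierstrassCurve.b₂, WeierstrassCurve.b₄,
    WeierstrassCurve.b₆]
  ring

theorem curve_Δ {R : Type*} [CommRing R] (a b : R) :
    (curve a b).Δ = -16 * (4 * a ^ 3 + 27 * b ^ 2) := by
  simp only [curve, WeierstrassCurve.Δ, WeierstrassCurve.b₂, WeierstrassCurve.b₄,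
    WeierstrassCurve.b₆, WeierstrassCurve.b₈]
  ring

theorem mem_maximalIdeal_pow_iff {x : ℤ_[ℓ]} {n : ℕ} :
    x ∈ IsLocalRing.maximalIdeal ℤ_[ℓ] ^ n ↔ (ℓ : ℤ_[ℓ]) ^ n ∣ x := by
  rw [PadicInt.maximalIdeal_eq_span_p, Ideal.span_singleton_pow, Ideal.mem_span_singleton]

theorem mem_maximalIdeal_iff_dvd {x : ℤ_[ℓ]} :
    x ∈ IsLocalRing.maximalIdeal ℤ_[ℓ] ↔ (ℓ : ℤ_[ℓ]) ∣ x := by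
  rw [PadicInt.maximalIdeal_eq_span_p, Ideal.mem_span_singleton]

theorem isUnit_iff_not_dvd {x : ℤ_[ℓ]} : IsUnit x ↔ ¬ (ℓ : ℤ_[ℓ]) ∣ x := by
  rw [← PadicInt.norm_lt_one_iff_dvd, ← PadicInt.not_isUnit_iff, not_not]

theorem isUnit_of_dvd_add {x y : ℤ_[ℓ]} (h : (ℓ : ℤ_[ℓ]) ∣ x + y) (hx : IsUnit x) :
    IsUnit y := by
  rw [isUnit_iff_not_dvd] at hx ⊢
  exact fun hy => hx ((dvd_add_left hy).1 h)

/-- A nodal integral equation has unit `c₄`, so `u ^ 4 c₄ = -48 a` shows that an admissible change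
of variables leading to it from a short equation has integral scaling factor `u`. If the short equation
is minimal then `u` is a unit, since otherwise this relation and `u ^ 6 c₆ = -864 b` would give
`ℓ ^ 4 ∣ a` and `ℓ ^ 6 ∣ b`. -/
theorem isUnit_and_discriminant_of_mem_localTypeI (h5 : 5 ≤ ℓ) {n : ℕ} (hn : 1 ≤ n)
    {a b : ℤ_[ℓ]} (hmin : (a, b) ∈ localMinimal ℓ) (h : (a, b) ∈ localTypeI ℓ n) :
    IsUnit a ∧ (ℓ : ℤ_[ℓ]) ^ n ∣ 4 * a ^ 3 + 27 * b ^ 2 ∧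
      ¬ (ℓ : ℤ_[ℓ]) ^ (n + 1) ∣ 4 * a ^ 3 + 27 * b ^ 2 := by
  obtain ⟨h2, h3⟩ := isUnit_two_and_three h5
  obtain ⟨C, V, hCV, ⟨rfl, -⟩ | ⟨-, ha₃, ha₄, -, hb₂, hΔ, hΔ'⟩⟩ := h
  · omega
  rw [mem_maximalIdeal_iff_dvd] at ha₃ ha₄
  rw [mem_maximalIdeal_pow_iff] at hΔ hΔ'
  have hb₄ : (ℓ : ℤ_[ℓ]) ∣ V.b₄ := (ha₄.mul_left 2).add (ha₃.mul_left V.a₁)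
  have hc₄ : IsUnit V.c₄ := by
    rw [isUnit_iff_not_dvd] at hb₂ ⊢
    rw [WeierstrassCurve.c₄, dvd_sub_left (hb₄.mul_left 24)]
    exact fun h => hb₂ (PadicInt.prime_p.dvd_of_dvd_pow h)
  have hu0 : (C.u : ℚ_[ℓ]) ≠ 0 := C.u.ne_zero
  have e4 : (C.u : ℚ_[ℓ]) ^ 4 * (V.c₄ : ℚ_[ℓ]) = ((-48 * a : ℤ_[ℓ]) : ℚ_[ℓ]) := by
    have := congrArg WeierstrassCurve.c₄ hCV
    rw [WeierstrassCurve.variableChange_c₄, WeierstrassCurve.map_c₄, WeierstrassCurve.map_c₄,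
      curve_c₄] at this
    change _ = (V.c₄ : ℚ_[ℓ]) at this
    rw [← this, Units.val_inv_eq_inv_val, inv_pow, mul_inv_cancel_left₀ (pow_ne_zero _ hu0)]
    rfl
  have e6 : (C.u : ℚ_[ℓ]) ^ 6 * (V.c₆ : ℚ_[ℓ]) = ((-864 * b : ℤ_[ℓ]) : ℚ_[ℓ]) := by
    have := congrArg WeierstrassCurve.c₆ hCV
    rw [WeierstrassCurve.variableChange_c₆, WeierstrassCurve.map_c₆, WeierstrassCurve.map_c₆,
      curve_c₆] at this
    change _ = (V.c₆ : ℚ_[ℓ]) at this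
    rw [← this, Units.val_inv_eq_inv_val, inv_pow, mul_inv_cancel_left₀ (pow_ne_zero _ hu0)]
    rfl
  have eΔ : (C.u : ℚ_[ℓ]) ^ 12 * (V.Δ : ℚ_[ℓ]) =
      ((-16 * (4 * a ^ 3 + 27 * b ^ 2) : ℤ_[ℓ]) : ℚ_[ℓ]) := by
    have := congrArg WeierstrassCurve.Δ hCV
    rw [WeierstrassCurve.variableChange_Δ, WeierstrassCurve.map_Δ, WeierstrassCurve.map_Δ,
      curve_Δ] at this
    change _ = (V.Δ : ℚ_[ℓ]) at this
    rw [← this, Units.val_inv_eq_inv_val, inv_pow, mul_inv_cancel_left₀ (pow_ne_zero _ hu0)]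
    rfl
  have hu1 : ‖(C.u : ℚ_[ℓ])‖ ≤ 1 := by
    have h4 : ‖(C.u : ℚ_[ℓ])‖ ^ 4 ≤ 1 := by
      have := congrArg norm e4
      rw [norm_mul, norm_pow, ← PadicInt.norm_def, ← PadicInt.norm_def,
        PadicInt.isUnit_iff.1 hc₄, mul_one] at this
      rw [this]
      exact PadicInt.norm_le_one _
    exact (pow_le_one_iff_of_nonneg (norm_nonneg _) (by norm_num)).1 h4
  -- Hence `u` is integral, and the three relations hold in `ℤ_[ℓ]`.
  obtain ⟨w, hw⟩ : ∃ w : ℤ_[ℓ], (w : ℚ_[ℓ]) = C.u := ⟨⟨_, hu1⟩, rfl⟩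
  rw [← hw] at e4 e6 eΔ
  have f4 : w ^ 4 * V.c₄ = -48 * a :=
    PadicInt.ext (by rw [PadicInt.coe_mul, PadicInt.coe_pow]; exact e4)
  have f6 : w ^ 6 * V.c₆ = -864 * b :=
    PadicInt.ext (by rw [PadicInt.coe_mul, PadicInt.coe_pow]; exact e6)
  have fΔ : w ^ 12 * V.Δ = -16 * (4 * a ^ 3 + 27 * b ^ 2) :=
    PadicInt.ext (by rw [PadicInt.coe_mul, PadicInt.coe_pow]; exact eΔ)
  have u48 : IsUnit (-48 : ℤ_[ℓ]) := by
    rw [show (-48 : ℤ_[ℓ]) = -(2 ^ 4 * 3) by norm_num]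
    exact ((h2.pow 4).mul h3).neg
  have u864 : IsUnit (-864 : ℤ_[ℓ]) := by
    rw [show (-864 : ℤ_[ℓ]) = -(2 ^ 5 * 3 ^ 3) by norm_num]
    exact ((h2.pow 5).mul (h3.pow 3)).neg
  have u16 : IsUnit (-16 : ℤ_[ℓ]) := by
    rw [show (-16 : ℤ_[ℓ]) = -(2 ^ 4) by norm_num]
    exact (h2.pow 4).neg
  have hwu : IsUnit w := by
    rw [isUnit_iff_not_dvd]
    intro hw
    have d4 : (ℓ : ℤ_[ℓ]) ^ 4 ∣ a :=
      u48.dvd_mul_left.1 (f4 ▸ (pow_dvd_pow_of_dvd hw 4).mul_right _)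
    have d6 : (ℓ : ℤ_[ℓ]) ^ 6 ∣ b :=
      u864.dvd_mul_left.1 (f6 ▸ (pow_dvd_pow_of_dvd hw 6).mul_right _)
    exact hmin.elim (fun h => h d4) fun h => h d6
  have hiff (m : ℕ) : (ℓ : ℤ_[ℓ]) ^ m ∣ 4 * a ^ 3 + 27 * b ^ 2 ↔ (ℓ : ℤ_[ℓ]) ^ m ∣ V.Δ := by
    rw [← u16.dvd_mul_left, ← fΔ, (hwu.pow 12).dvd_mul_left]
  refine ⟨isUnit_of_mul_isUnit_right (f4 ▸ (hwu.pow 4).mul hc₄), (hiff n).2 hΔ, ?_⟩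
  rwa [hiff]

/-- Conversely the reduction has the double root `x₀ = -3 b / (2 a)`, and translating it to the
origin gives an equation as required by Tate's algorithm. -/
theorem mem_localTypeI_of_isUnit (h5 : 5 ≤ ℓ) {n : ℕ} (hn : 1 ≤ n) {a b : ℤ_[ℓ]} (ha : IsUnit a)
    (hF : (ℓ : ℤ_[ℓ]) ^ n ∣ 4 * a ^ 3 + 27 * b ^ 2)
    (hF' : ¬ (ℓ : ℤ_[ℓ]) ^ (n + 1) ∣ 4 * a ^ 3 + 27 * b ^ 2) : (a, b) ∈ localTypeI ℓ n := by
  obtain ⟨h2, h3⟩ := isUnit_two_and_three h5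
  obtain ⟨v, hv⟩ := (h2.mul ha).exists_right_inv
  have hF1 : (ℓ : ℤ_[ℓ]) ∣ 4 * a ^ 3 + 27 * b ^ 2 :=
    (dvd_pow_self _ (Nat.one_le_iff_ne_zero.1 hn)).trans hF
  have hb : IsUnit b := by
    have h4a : IsUnit (4 * a ^ 3) := by
      rw [show (4 : ℤ_[ℓ]) = 2 ^ 2 by norm_num]
      exact (h2.pow 2).mul (ha.pow 3)
    have := isUnit_of_mul_isUnit_right (isUnit_of_dvd_add hF1 h4a)
    exact (isUnit_pow_iff two_ne_zero).1 this
  have hvu : IsUnit v := IsUnit.of_mul_eq_one _ ((mul_comm _ _).trans hv)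
  obtain ⟨x, hx⟩ : ∃ x, x = -3 * b * v := ⟨_, rfl⟩
  have hxu : IsUnit x := hx ▸ (h3.neg.mul hb).mul hvu
  let V : WeierstrassCurve ℤ_[ℓ] := ⟨0, 3 * x, 0, 3 * x ^ 2 + a, x ^ 3 + a * x + b⟩
  have hΔ : V.Δ = -16 * (4 * a ^ 3 + 27 * b ^ 2) := by
    simp only [V, WeierstrassCurve.Δ, WeierstrassCurve.b₂, WeierstrassCurve.b₄,
      WeierstrassCurve.b₆, WeierstrassCurve.b₈]
    ring
  have u16 : IsUnit (-16 : ℤ_[ℓ]) := by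
    rw [show (-16 : ℤ_[ℓ]) = -(2 ^ 4) by norm_num]
    exact (h2.pow 4).neg
  refine ⟨⟨1, (x : ℚ_[ℓ]), 0, 0⟩, V, ?_, Or.inr ⟨hn, ?_, ?_, ?_, ?_, ?_, ?_⟩⟩
  · have e3 : ((3 : ℤ_[ℓ]) : ℚ_[ℓ]) = 3 := rfl
    ext <;> simp [WeierstrassCurve.variableChange_def, curve, V, e3]
    · ring
    · ring
  · exact Ideal.zero_mem _
  · rw [mem_maximalIdeal_iff_dvd]
    have : V.a₄ = v ^ 2 * (4 * a ^ 3 + 27 * b ^ 2) := by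
      simp only [V, hx]
      linear_combination (-a - 2 * a ^ 2 * v) * hv
    exact this ▸ hF1.mul_left _
  · rw [mem_maximalIdeal_iff_dvd]
    have : V.a₆ = -b * v ^ 3 * (4 * a ^ 3 + 27 * b ^ 2) := by
      simp only [V, hx]
      linear_combination b * (2 * a * v - 1) * (a * v + 1) * hv
    exact this ▸ hF1.mul_left _
  · have : V.b₂ = 2 ^ 2 * 3 * x := by
      simp only [V, WeierstrassCurve.b₂]
      ring
    rw [this]
    exact ((h2.pow 2).mul h3).mul hxu
  · rwa [mem_maximalIdeal_pow_iff, hΔ, u16.dvd_mul_left]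
  · rwa [mem_maximalIdeal_pow_iff, hΔ, u16.dvd_mul_left]

end Local

/-! ### Local densities -/

theorem toLocal_mem_localMinimal_iff {ℓ : ℕ} [Fact ℓ.Prime] {p : ℤ × ℤ} :
    toLocal ℓ p ∈ localMinimal ℓ ↔ p ∉ dvdSet (ℓ ^ 4) (ℓ ^ 6) := by
  rw [mem_dvdSet, not_and_or]
  push_cast
  rw [← PadicInt.pow_p_dvd_int_iff, ← PadicInt.pow_p_dvd_int_iff]
  rfl

/-- Pairs with `ℓ ∤ a` and `4 a³ + 27 b² ≡ 0` modulo `ℓ ^ k`. For `ℓ ≥ 5` and `k ≥ 1` these are the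
equations whose reduction has a node and whose discriminant is divisible by `ℓ ^ k`. -/
def nodal (ℓ k : ℕ) : Set (ℤ × ℤ) :=
  {p | ¬ (ℓ : ℤ) ∣ p.1 ∧ (ℓ : ℤ) ^ k ∣ 4 * p.1 ^ 3 + 27 * p.2 ^ 2}

theorem minimal_and_typeI_iff {ℓ : ℕ} [Fact ℓ.Prime] (h5 : 5 ≤ ℓ) {n : ℕ} (hn : 1 ≤ n)
    {p : ℤ × ℤ} : toLocal ℓ p ∈ localMinimal ℓ ∧ toLocal ℓ p ∈ localTypeI ℓ n ↔
      p ∈ nodal ℓ n \ nodal ℓ (n + 1) := by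
  have hdvd (x : ℤ) (m : ℕ) := PadicInt.pow_p_dvd_int_iff (p := ℓ) m x
  have hu : IsUnit (p.1 : ℤ_[ℓ]) ↔ ¬ (ℓ : ℤ) ∣ p.1 := by
    rw [isUnit_iff_not_dvd, ← pow_one (ℓ : ℤ_[ℓ]), hdvd, pow_one]
  have hF (m : ℕ) : (ℓ : ℤ_[ℓ]) ^ m ∣ 4 * (p.1 : ℤ_[ℓ]) ^ 3 + 27 * (p.2 : ℤ_[ℓ]) ^ 2 ↔
      (ℓ : ℤ) ^ m ∣ 4 * p.1 ^ 3 + 27 * p.2 ^ 2 := by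
    rw [← hdvd]
    push_cast
    rfl
  simp only [nodal, Set.mem_sdiff, Set.mem_ofPred_eq, not_and, ← hu, ← hF]
  constructor
  · rintro ⟨hm, ht⟩
    obtain ⟨h1, h2, h3⟩ := isUnit_and_discriminant_of_mem_localTypeI h5 hn hm ht
    exact ⟨⟨h1, h2⟩, fun _ => h3⟩
  · rintro ⟨⟨h1, h2⟩, h3⟩
    refine ⟨Or.inl fun h4 => ?_, mem_localTypeI_of_isUnit h5 hn h1 h2 (h3 h1)⟩
    exact isUnit_iff_not_dvd.1 h1 ((dvd_pow_self _ (by norm_num)).trans h4)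

theorem nodal_succ_subset (ℓ k : ℕ) : nodal ℓ (k + 1) ⊆ nodal ℓ k :=
  fun _ hp => ⟨hp.1, (pow_dvd_pow _ k.le_succ).trans hp.2⟩

/-- Over any ring in which `6` is a unit, `t ↦ (-3 t², 2 t³)` parametrizes the singular equations
with unit `a`, the inverse being `t = -3 b / (2 a)`. -/
theorem range_units_param {R : Type*} [CommRing R] (h2 : IsUnit (2 : R)) (h3 : IsUnit (3 : R)) :
    Set.range (fun t : Rˣ => ((-3 * (t : R) ^ 2, 2 * (t : R) ^ 3) : R × R)) =
      {p | IsUnit p.1 ∧ 4 * p.1 ^ 3 + 27 * p.2 ^ 2 = 0} := by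
  ext ⟨a, b⟩
  constructor
  · rintro ⟨t, ht⟩
    obtain ⟨rfl, rfl⟩ := Prod.mk.inj ht
    exact ⟨h3.neg.mul (t.isUnit.pow 2), by ring⟩
  · rintro ⟨ha, hF⟩
    simp only at ha hF
    obtain ⟨v, hv⟩ := (h2.mul ha).exists_right_inv
    have hvu : IsUnit v := IsUnit.of_mul_eq_one _ ((mul_comm _ _).trans hv)
    have hb : IsUnit b := by
      have : IsUnit (27 * b ^ 2) := by
        rw [show 27 * b ^ 2 = -(2 ^ 2 * a ^ 3) by linear_combination hF]
        exact ((h2.pow 2).mul (ha.pow 3)).neg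
      exact (isUnit_pow_iff two_ne_zero).1 (isUnit_of_mul_isUnit_right this)
    obtain ⟨t, ht⟩ := (h3.neg.mul hb).mul hvu
    refine ⟨t, Prod.ext ?_ ?_⟩
    · simp only [ht]
      linear_combination (a + 2 * a ^ 2 * v) * hv - v ^ 2 * hF
    · simp only [ht]
      linear_combination b * (1 + 2 * a * v + 4 * a ^ 2 * v ^ 2) * hv - 2 * b * v ^ 3 * hF

theorem units_param_injective {R : Type*} [CommRing R] (h2 : IsUnit (2 : R))
    (h3 : IsUnit (3 : R)) :
    Function.Injective (fun t : Rˣ => ((-3 * (t : R) ^ 2, 2 * (t : R) ^ 3) : R × R)) := by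
  intro t s h
  obtain ⟨h1, h1'⟩ := Prod.mk.inj h
  have hsq : (t : R) ^ 2 = s ^ 2 := h3.neg.mul_left_cancel h1
  have hcu : (t : R) ^ 3 = s ^ 3 := h2.mul_left_cancel h1'
  refine Units.ext ((t.isUnit.pow 2).mul_left_cancel ?_)
  rw [← pow_succ, hcu, hsq, ← pow_succ]

theorem nodal_eq_preimage {ℓ k : ℕ} (hk : 1 ≤ k) (hℓ : ℓ.Prime) :
    nodal ℓ k = red (ℓ ^ k) ⁻¹' {p | IsUnit p.1 ∧ 4 * p.1 ^ 3 + 27 * p.2 ^ 2 = 0} := by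
  ext p
  simp only [nodal, red, Set.mem_ofPred_eq, Set.mem_preimage]
  have hF : (4 * (p.1 : ZMod (ℓ ^ k)) ^ 3 + 27 * (p.2 : ZMod (ℓ ^ k)) ^ 2) =
      ((4 * p.1 ^ 3 + 27 * p.2 ^ 2 : ℤ) : ZMod (ℓ ^ k)) := by push_cast; rfl
  rw [hF, ZMod.intCast_zmod_eq_zero_iff_dvd, ZMod.coe_int_isUnit_iff_isCoprime, Nat.cast_pow,
    IsCoprime.pow_left_iff hk, (Nat.prime_iff_prime_int.1 hℓ).coprime_iff_not_dvd]

theorem isPeriodic_nodal {ℓ k : ℕ} (hk : 1 ≤ k) (hℓ : ℓ.Prime) :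
    IsPeriodic (ℓ ^ k) (nodal ℓ k) :=
  ⟨_, nodal_eq_preimage hk hℓ⟩

theorem hasBoxDensity_nodal {ℓ k : ℕ} (hk : 1 ≤ k) (hℓ : ℓ.Prime) (h5 : 5 ≤ ℓ) :
    HasBoxDensity (nodal ℓ k) ((ℓ - 1) / (ℓ : ℝ) ^ (k + 1)) := by
  have : NeZero (ℓ ^ k) := ⟨pow_ne_zero _ hℓ.ne_zero⟩
  have hunit {r : ℕ} (hr : r.Prime) (hrℓ : r ≠ ℓ) : IsUnit (r : ZMod (ℓ ^ k)) := by
    rw [ZMod.isUnit_iff_coprime]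
    exact Nat.Coprime.pow_right _ ((Nat.coprime_primes hr hℓ).2 hrℓ)
  have h2 : IsUnit (2 : ZMod (ℓ ^ k)) := by exact_mod_cast hunit Nat.prime_two (by omega)
  have h3 : IsUnit (3 : ZMod (ℓ ^ k)) := by exact_mod_cast hunit Nat.prime_three (by omega)
  rw [nodal_eq_preimage hk hℓ, ← range_units_param h2 h3]
  convert hasBoxDensity_preimage_red (ℓ ^ k) _ using 1
  rw [← Set.image_univ, Set.ncard_image_of_injective _ (units_param_injective h2 h3),
    Set.ncard_univ, Nat.card_eq_fintype_card, ZMod.card_units_eq_totient,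
    Nat.totient_prime_pow hℓ hk, Nat.cast_mul, Nat.cast_sub hℓ.one_le]
  have hℓ0 : (ℓ : ℝ) ≠ 0 := by exact_mod_cast hℓ.ne_zero
  obtain ⟨j, rfl⟩ := Nat.exists_eq_add_of_le' hk
  push_cast
  field_simp
  ring

theorem isPeriodic_typeI {ℓ n : ℕ} (hn : 1 ≤ n) (hℓ : ℓ.Prime) :
    IsPeriodic (ℓ ^ (n + 1)) (nodal ℓ n \ nodal ℓ (n + 1)) :=
  ((isPeriodic_nodal hn hℓ).of_dvd (pow_dvd_pow _ n.le_succ)).diff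
    (isPeriodic_nodal (by omega) hℓ)

theorem hasBoxDensity_typeI {ℓ n : ℕ} (hn : 1 ≤ n) (hℓ : ℓ.Prime) (h5 : 5 ≤ ℓ) :
    HasBoxDensity (nodal ℓ n \ nodal ℓ (n + 1)) (((ℓ : ℝ) - 1) ^ 2 / (ℓ : ℝ) ^ (n + 2)) := by
  convert (hasBoxDensity_nodal hn hℓ h5).diff (hasBoxDensity_nodal (by omega) hℓ h5)
    (nodal_succ_subset ℓ n) using 1
  have hℓ0 : (ℓ : ℝ) ≠ 0 := by exact_mod_cast hℓ.ne_zero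
  field_simp
  ring

theorem isPeriodic_minimal (ℓ : ℕ) : IsPeriodic (ℓ ^ 6) (dvdSet (ℓ ^ 4) (ℓ ^ 6))ᶜ := by
  have h46 : ℓ ^ 4 ∣ ℓ ^ 6 := pow_dvd_pow _ (by norm_num)
  refine ⟨{p | ¬ (ZMod.castHom h46 (ZMod (ℓ ^ 4)) p.1 = 0 ∧ p.2 = 0)}, ?_⟩
  ext p
  simp only [Set.mem_compl_iff, mem_dvdSet, Set.mem_preimage, red, Set.mem_ofPred_eq,
    map_intCast, ZMod.intCast_zmod_eq_zero_iff_dvd]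

theorem hasBoxDensity_minimal {ℓ : ℕ} (hℓ : ℓ.Prime) :
    HasBoxDensity (dvdSet (ℓ ^ 4) (ℓ ^ 6))ᶜ (1 - ((ℓ : ℝ) ^ 10)⁻¹) := by
  have h := hasBoxDensity_univ.diff
    (hasBoxDensity_residue (pow_pos hℓ.pos 4) (pow_pos hℓ.pos 6) 0 0) (Set.subset_univ _)
  have hd : 1 - ((ℓ : ℝ) ^ 10)⁻¹ = 1 - 1 / (((ℓ ^ 4 : ℕ) : ℝ) * ((ℓ ^ 6 : ℕ) : ℝ)) := by
    push_cast
    rw [← pow_add, one_div]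
  rwa [← Set.compl_eq_univ_sdiff, ← hd] at h

/-! ### Assembling the local conditions -/

theorem multipliable_one_sub_inv_pow :
    Multipliable fun ℓ : Nat.Primes => 1 - ((ℓ : ℝ) ^ 10)⁻¹ := by
  have h := multipliable_one_add_of_summable (f := fun ℓ : Nat.Primes => -((ℓ : ℝ) ^ 10)⁻¹)
    (by simpa using summable_primes_inv_pow (k := 10) (by norm_num))
  simpa only [← sub_eq_add_neg] using h

theorem multipliable_one_sub_inv_pow_subtype (S : Finset Nat.Primes) :
    Multipliable fun ℓ : {ℓ : Nat.Primes // ℓ ∉ S} => 1 - (((ℓ : Nat.Primes) : ℝ) ^ 10)⁻¹ := by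
  have h := multipliable_one_add_of_summable
    (f := fun ℓ : {ℓ : Nat.Primes // ℓ ∉ S} => -(((ℓ : Nat.Primes) : ℝ) ^ 10)⁻¹)
    (by simpa [Function.comp_def] using
      (summable_primes_inv_pow (k := 10) (by norm_num)).subtype fun ℓ => ℓ ∉ S)
  simpa only [← sub_eq_add_neg] using h

theorem hasDensity_minimalModelsOfType (S : Finset Nat.Primes) (hS : ∀ ℓ ∈ S, 5 ≤ (ℓ : ℕ)) {n : ℕ}
    (hn : 1 ≤ n) : HasDensity (minimalModelsOfType S n)
      ((∏ ℓ ∈ S, ((ℓ : ℝ) - 1) ^ 2 / (ℓ : ℝ) ^ (n + 2)) *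
        ∏' ℓ : {ℓ : Nat.Primes // ℓ ∉ S}, (1 - (((ℓ : Nat.Primes) : ℝ) ^ 10)⁻¹)) := by
  classical
  let L (ℓ : Nat.Primes) : Set (ℤ × ℤ) :=
    if ℓ ∈ S then nodal ℓ n \ nodal ℓ (n + 1) else (dvdSet ((ℓ : ℕ) ^ 4) ((ℓ : ℕ) ^ 6))ᶜ
  let d (ℓ : Nat.Primes) : ℝ :=
    if ℓ ∈ S then ((ℓ : ℝ) - 1) ^ 2 / (ℓ : ℝ) ^ (n + 2) else 1 - ((ℓ : ℝ) ^ 10)⁻¹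
  have hL : minimalModelsOfType S n = ⋂ ℓ, L ℓ := by
    ext p
    simp only [minimalModelsOfType, minimalModels, Set.mem_ofPred_eq, Set.mem_iInter]
    rw [← forall_and]
    refine forall_congr' fun ℓ => ?_
    have : Fact (ℓ : ℕ).Prime := ⟨ℓ.2⟩
    by_cases hℓ : ℓ ∈ S
    · simp only [L, hℓ, if_true, forall_const]
      exact minimal_and_typeI_iff (hS ℓ hℓ) hn
    · simp only [L, hℓ, if_false, false_imp_iff, and_true]
      exact toLocal_mem_localMinimal_iff
  rw [hL]
  refine (hasBoxDensity_iInter (d := d) (e := fun ℓ => if ℓ ∈ S then n + 1 else 6) S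
    (fun ℓ => ?_) (fun ℓ => ?_) (fun ℓ hℓ => ?_) ?_).hasDensity
  · by_cases hℓ : ℓ ∈ S
    · simp only [L, hℓ, if_true]
      exact isPeriodic_typeI hn ℓ.2
    · simp only [L, hℓ, if_false]
      exact isPeriodic_minimal ℓ
  · by_cases hℓ : ℓ ∈ S
    · simp only [L, d, hℓ, if_true]
      exact hasBoxDensity_typeI hn ℓ.2 (hS ℓ hℓ)
    · simp only [L, d, hℓ, if_false]
      exact hasBoxDensity_minimal ℓ.2
  · simp only [L, hℓ, if_false, subset_rfl]
  · have h1 : ∏ ℓ ∈ S, ((ℓ : ℝ) - 1) ^ 2 / (ℓ : ℝ) ^ (n + 2) = ∏ ℓ ∈ S, d ℓ :=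
      Finset.prod_congr rfl fun ℓ hℓ => by simp only [d, hℓ, if_true]
    have h2 : (fun ℓ : {ℓ : Nat.Primes // ℓ ∉ S} => 1 - (((ℓ : Nat.Primes) : ℝ) ^ 10)⁻¹) =
        fun ℓ : {ℓ : Nat.Primes // ℓ ∉ S} => d ℓ :=
      funext fun ℓ => by simp only [d, ℓ.2, if_false]
    have h3 := (multipliable_one_sub_inv_pow_subtype S).hasProd
    rw [h2] at h3
    rw [h1, h2]
    exact (S.hasProd d).mul_compl h3

theorem tprod_one_sub_inv_pow_eq_inv_zeta :
    ((∏' ℓ : Nat.Primes, (1 - ((ℓ : ℝ) ^ 10)⁻¹) : ℝ) : ℂ) = 1 / riemannZeta 10 := by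
  have hz := riemannZeta_eulerProduct_hasProd (s := 10) (by norm_num)
  have hr := (multipliable_one_sub_inv_pow.hasProd).map Complex.ofRealHom
    Complex.continuous_ofReal
  have hone := hr.mul hz
  have : (fun ℓ : Nat.Primes => (Complex.ofRealHom ∘ fun ℓ : Nat.Primes =>
      1 - ((ℓ : ℝ) ^ 10)⁻¹) ℓ * (1 - (ℓ : ℂ) ^ (-10 : ℂ))⁻¹) = fun _ => 1 := by
    funext ℓ
    have hp : (ℓ : ℂ) ^ (-10 : ℂ) = ((ℓ : ℂ) ^ 10)⁻¹ := by
      rw [Complex.cpow_neg]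
      norm_cast
    have hne : (1 : ℂ) - ((ℓ : ℂ) ^ 10)⁻¹ ≠ 0 := by
      have h1 : (1 : ℝ) < (ℓ : ℝ) ^ 10 :=
        one_lt_pow₀ (by exact_mod_cast ℓ.2.one_lt) (by norm_num)
      have h2 : (1 : ℝ) - ((ℓ : ℝ) ^ 10)⁻¹ ≠ 0 := (sub_pos.2 (inv_lt_one_of_one_lt₀ h1)).ne'
      have h3 := Complex.ofReal_ne_zero.2 h2
      push_cast at h3
      exact h3
    rw [hp]
    simp only [Function.comp_apply, Complex.ofRealHom_eq_coe]
    push_cast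
    exact mul_inv_cancel₀ hne
  rw [this] at hone
  have h := hone.unique hasProd_one
  exact eq_one_div_of_mul_eq_one_left h

end ShortWeierstrass

theorem corollary4p6 :
    ((Multipliable fun ℓ : Nat.Primes => 1 - ((ℓ : ℝ) ^ 10)⁻¹) ∧
      ShortWeierstrass.HasDensity ShortWeierstrass.minimalModels
        (∏' ℓ : Nat.Primes, (1 - ((ℓ : ℝ) ^ 10)⁻¹)) ∧
      ((∏' ℓ : Nat.Primes, (1 - ((ℓ : ℝ) ^ 10)⁻¹) : ℝ) : ℂ) = 1 / riemannZeta 10) ∧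
    (∀ (S : Finset Nat.Primes), (∀ ℓ ∈ S, 5 ≤ (ℓ : ℕ)) → ∀ n : ℕ, 1 ≤ n →
      (Multipliable fun ℓ : {ℓ : Nat.Primes // ℓ ∉ S} => 1 - (((ℓ : Nat.Primes) : ℝ) ^ 10)⁻¹) ∧
      ShortWeierstrass.HasDensity (ShortWeierstrass.minimalModelsOfType S n)
        ((∏ ℓ ∈ S, ((ℓ : ℝ) - 1) ^ 2 / (ℓ : ℝ) ^ (n + 2)) *
          ∏' ℓ : {ℓ : Nat.Primes // ℓ ∉ S}, (1 - (((ℓ : Nat.Primes) : ℝ) ^ 10)⁻¹))) := by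
  refine ⟨⟨ShortWeierstrass.multipliable_one_sub_inv_pow, ?_,
    ShortWeierstrass.tprod_one_sub_inv_pow_eq_inv_zeta⟩, fun S hS n hn =>
    ⟨ShortWeierstrass.multipliable_one_sub_inv_pow_subtype S,
      ShortWeierstrass.hasDensity_minimalModelsOfType S hS hn⟩⟩
  -- No conditions beyond minimality are imposed when the finite set of primes is empty.
  have h := ShortWeierstrass.hasDensity_minimalModelsOfType ∅ (by simp) le_rfl
  have hset : ShortWeierstrass.minimalModelsOfType ∅ 1 = ShortWeierstrass.minimalModels := by
    ext p
    simp [ShortWeierstrass.minimalModelsOfType]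
  rw [hset, Finset.prod_empty, one_mul] at h
  convert h using 1
  exact ((Equiv.subtypeUnivEquiv fun ℓ : Nat.Primes => Finset.notMem_empty ℓ).tprod_eq
    fun ℓ : Nat.Primes => 1 - ((ℓ : ℝ) ^ 10)⁻¹).symm
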